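/- Let $F$ be a field of characteristic $0$; all algebras are (not necessarily associative) algebras over $F$. For a superalgebra $A=A_0\oplus A_1$ (that is, $A_iA_j\subseteq A_{i+j \bmod 2}$) let $G(A)=G_0\otimes A_0+G_1\otimes A_1$ be its Grassmann envelope, where $G=G_0\oplus G_1$ is the Grassmann algebra on countably many generators with its natural $\mathbb Z_2$-grading. For a multilinear polynomial $f$, the superalgebra $A$ is said to satisfy the superidentity $\tilde f=0$ if $G(A)$ satisfies the identity $f=0$. For a variety $\mathcal V$ of algebras defined by multilinear identities, a $\mathcal V$-superalgebra is a superalgebra whose Grassmann envelope lies in $\mathcal V$; let $\tilde{\mathcal V}$ be the class of all $\mathcal V$-superalgebras, and for integers $r,s\ge 0$ let $\mathcal V_{r,s}$ be the supervariety generated by the free $\mathcal V$-superalgebra on $r$ even and $s$ odd generators, i.e. the class of all superalgebras that satisfy every superidentity $\tilde f=0$ ($f$ multilinear) of that free superalgebra (so $\mathcal V_{0,0}$ consists of the zero superalgebras). The basic superrank of $\mathcal V$ is said to be infinite if $\mathcal V_{r,s}\neq\tilde{\mathcal V}$ for all $r,s\ge 0$. **Theorem.** For $\varepsilon=\pm1$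 let $\mathcal V^{\langle\varepsilon\rangle}$ be the variety of all algebras satisfying the identities $$(xy)(zt)=0,\qquad (x,y,z)=\varepsilon\,(x,z,y),\qquad \bigl\langle\langle x,y\rangle_\varepsilon,z\bigr\rangle_\varepsilon=0,$$ where $(x,y,z)=(xy)z-x(yz)$ and $\langle x,y\rangle_\varepsilon=xy-\varepsilon\,yx$. (For $\varepsilon=1$ these are the metabelian right symmetric algebras that are Lie-nilpotent of index at most $2$; for $\varepsilon=-1$, the metabelian right alternative algebras that are Jordan-nilpotent of index at most $2$.) Then, for both $\varepsilon=1$ and $\varepsilon=-1$, the basic superrank of $\mathcal V^{\langle\varepsilon\rangle}$ is infinite. -/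

import Mathlib

open scoped TensorProduct

universe u

namespace Superrank

/-! ### Nonassociative polynomials and polynomial identities -/

/-- Nonassociative polynomials over `F` without constant term, in the countably many
variables `x 0, x 1, x 2, …`. -/
abbrev NAPoly (F : Type u) [Field F] : Type u := FreeNonUnitalNonAssocAlgebra F ℕ

/-- The `n`-th variable. -/
noncomputable def x (F : Type u) [Field F] (n : ℕ) : NAPoly F :=
  FreeNonUnitalNonAssocAlgebra.of F n

/-- The algebra `A` satisfies the polynomial identity `f = 0`: the polynomial `f` vanishes under
every substitution of elements of `A` for the variables. -/
def Satisfies {F : Type u} [Field F] (f : NAPoly F) (A : Type u) [NonUnitalNonAssocRing A]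
    [Module F A] [IsScalarTower F A A] [SMulCommClass F A A] : Prop :=
  ∀ a : ℕ → A, FreeNonUnitalNonAssocAlgebra.lift F a f = 0

/-- The multiset of letters of a nonassociative monomial. -/
def letters {X : Type*} : FreeMagma X → Multiset X
  | FreeMagma.of a => {a}
  | FreeMagma.mul v w => letters v + letters w

/-- `f` is multilinear: for some finite set `s` of variables, every variable of `s` occurs exactly
once in every monomial of `f`, and no other variable occurs. -/
def IsMultilinear {F : Type u} [Field F] (f : NAPoly F) : Prop :=
  ∃ s : Finset ℕ, ∀ m ∈ f.coeff.support, letters m = s.val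

/-! ### Superalgebras and Grassmann envelopes -/

/-- A (not necessarily associative or unital) superalgebra over `F`: an algebra `A = A₀ ⊕ A₁` with
`Aᵢ Aⱼ ⊆ Aᵢ₊ⱼ`, the indices being taken modulo `2`. -/
structure Superalgebra (F : Type u) [Field F] : Type (u + 1) where
  /-- the underlying algebra -/
  carrier : Type u
  [ring : NonUnitalNonAssocRing carrier]
  [module : Module F carrier]
  [isScalarTower : IsScalarTower F carrier carrier]
  [smulCommClass : SMulCommClass F carrier carrier]
  /-- the even part `part 0` and the odd part `part 1` -/
  part : ZMod 2 → Submodule F carrier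
  isCompl : IsCompl (part 0) (part 1)
  mul_mem : ∀ (i j : ZMod 2) (a b : carrier), a ∈ part i → b ∈ part j → a * b ∈ part (i + j)

attribute [instance] Superalgebra.ring Superalgebra.module Superalgebra.isScalarTower
  Superalgebra.smulCommClass

/-- The Grassmann algebra on countably many generators `e 0, e 1, …`. -/
abbrev Grassmann (F : Type u) [Field F] : Type u := ExteriorAlgebra F (ℕ →₀ F)

/-- The homogeneous components of the Grassmann algebra for its natural `ℤ/2`-grading:
`grassmannPart F 0` (resp. `grassmannPart F 1`) is spanned by the words of even (resp. odd)
length in the generators. -/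
noncomputable abbrev grassmannPart (F : Type u) [Field F] (i : ZMod 2) : Submodule F (Grassmann F) :=
  CliffordAlgebra.evenOdd (0 : QuadraticForm F (ℕ →₀ F)) i

/-- The Grassmann envelope `G(A) = G₀ ⊗ A₀ + G₁ ⊗ A₁`, a subalgebra of `G ⊗ A`. -/
noncomputable def envelope {F : Type u} [Field F] (A : Superalgebra F) :
    NonUnitalSubalgebra F (Grassmann F ⊗[F] A.carrier) :=
  { Submodule.span F {t | ∃ (i : ZMod 2), ∃ g ∈ grassmannPart F i, ∃ a ∈ A.part i,
      t = g ⊗ₜ[F] a} with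
    mul_mem' := by
      intro p q hp hq
      change p * q ∈ Submodule.span F _
      change p ∈ Submodule.span F _ at hp
      change q ∈ Submodule.span F _ at hq
      induction hp using Submodule.span_induction with
      | zero => rw [zero_mul]; exact zero_mem _
      | add v w _ _ hv hw => rw [add_mul]; exact add_mem hv hw
      | smul c v _ hv => rw [smul_mul_assoc]; exact Submodule.smul_mem _ c hv
      | mem v hv =>
        obtain ⟨i, g, hg, a, ha, rfl⟩ := hv
        induction hq using Submodule.span_induction with
        | zero => rw [mul_zero]; exact zero_mem _
        | add v w _ _ hv hw => rw [mul_add]; exact add_mem hv hw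
        | smul c v _ hv => rw [mul_smul_comm]; exact Submodule.smul_mem _ c hv
        | mem v hv =>
          obtain ⟨j, h, hh, b, hb, rfl⟩ := hv
          refine Submodule.subset_span ⟨i + j, g * h, ?_, a * b, A.mul_mem i j a b ha hb, ?_⟩
          · exact SetLike.mul_mem_graded hg hh
          · exact Algebra.TensorProduct.tmul_mul_tmul g h a b }

/-- For multilinear `f`: the superalgebra `A` satisfies the superidentity obtained from `f = 0`
by superization, that is, the Grassmann envelope of `A` satisfies the identity `f = 0`. -/
def SuperSatisfies {F : Type u} [Field F] (f : NAPoly F) (A : Superalgebra F) : Prop :=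
  Satisfies f (envelope A)

/-! ### Supervarieties

A variety `V` of algebras is given by a set `S` of (multilinear) polynomials: it consists of the
algebras that satisfy all identities `f = 0`, `f ∈ S`. -/

/-- The class of all `V`-superalgebras, i.e. of the superalgebras whose Grassmann envelope
lies in the variety `V` defined by `S`. -/
def superVariety {F : Type u} [Field F] (S : Set (NAPoly F)) : Set (Superalgebra.{u} F) :=
  {A | ∀ f ∈ S, SuperSatisfies f A}

/-- The supervariety generated by a superalgebra `B`: the class of the superalgebras that satisfy
all superidentities of `B`. -/
def generatedBy {F : Type u} [Field F] (B : Superalgebra.{u} F) : Set (Superalgebra.{u} F) :=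
  {A | ∀ f : NAPoly F, IsMultilinear f → SuperSatisfies f B → SuperSatisfies f A}

/-! ### The free `V`-superalgebra on `r` even and `s` odd generators -/

/-- Parity of a nonassociative monomial in `r` even and `s` odd letters. -/
def parity {r s : ℕ} : FreeMagma (Fin r ⊕ Fin s) → ZMod 2
  | FreeMagma.of (Sum.inl _) => 0
  | FreeMagma.of (Sum.inr _) => 1
  | FreeMagma.mul v w => parity v + parity w

/-- Nonassociative polynomials in `r` even and `s` odd variables. -/
abbrev SuperPoly (F : Type u) [Field F] (r s : ℕ) : Type u :=
  FreeNonUnitalNonAssocAlgebra F (Fin r ⊕ Fin s)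

/-- The span of the monomials of parity `i`. -/
noncomputable def superPolyPart (F : Type u) [Field F] (r s : ℕ) (i : ZMod 2) :
    Submodule F (SuperPoly F r s) :=
  Submodule.span F {p | ∃ m : FreeMagma (Fin r ⊕ Fin s), parity m = i ∧
    p = MonoidAlgebra.single m 1}

/-- The homomorphism `φ` sends the even generators to even elements and the odd generators to
odd elements. -/
def IsGraded {F : Type u} [Field F] {r s : ℕ} (A : Superalgebra.{u} F)
    (φ : SuperPoly F r s →ₙₐ[F] A.carrier) : Prop :=
  (∀ i : Fin r, φ (FreeNonUnitalNonAssocAlgebra.of F (Sum.inl i)) ∈ A.part 0) ∧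
  (∀ j : Fin s, φ (FreeNonUnitalNonAssocAlgebra.of F (Sum.inr j)) ∈ A.part 1)

/-- The ideal of all polynomials in `r` even and `s` odd variables that vanish in every
`V`-superalgebra. -/
def relations {F : Type u} [Field F] (S : Set (NAPoly F)) (r s : ℕ) :
    Submodule F (SuperPoly F r s) where
  carrier := {p | ∀ A ∈ superVariety S, ∀ φ : SuperPoly F r s →ₙₐ[F] A.carrier,
    IsGraded A φ → φ p = 0}
  zero_mem' := fun _ _ φ _ => map_zero φ
  add_mem' := fun {p q} hp hq A hA φ hφ => by
    rw [map_add, hp A hA φ hφ, hq A hA φ hφ, add_zero]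
  smul_mem' := fun c p hp A hA φ hφ => by
    rw [map_smul, hp A hA φ hφ, smul_zero]

theorem relations_mul_right {F : Type u} [Field F] (S : Set (NAPoly F)) (r s : ℕ)
    {p : SuperPoly F r s} (hp : p ∈ relations S r s) (q : SuperPoly F r s) :
    p * q ∈ relations S r s := fun A hA φ hφ => by
  rw [map_mul, hp A hA φ hφ, zero_mul]

theorem relations_mul_left {F : Type u} [Field F] (S : Set (NAPoly F)) (r s : ℕ)
    {p : SuperPoly F r s} (hp : p ∈ relations S r s) (q : SuperPoly F r s) :
    q * p ∈ relations S r s := fun A hA φ hφ => by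
  rw [map_mul, hp A hA φ hφ, mul_zero]

/-- The underlying space of the free `V`-superalgebra. -/
def FreeCarrier {F : Type u} [Field F] (S : Set (NAPoly F)) (r s : ℕ) : Type u :=
  SuperPoly F r s ⧸ relations S r s

noncomputable instance {F : Type u} [Field F] (S : Set (NAPoly F)) (r s : ℕ) :
    AddCommGroup (FreeCarrier S r s) :=
  inferInstanceAs (AddCommGroup (SuperPoly F r s ⧸ relations S r s))

noncomputable instance {F : Type u} [Field F] (S : Set (NAPoly F)) (r s : ℕ) :
    Module F (FreeCarrier S r s) :=
  inferInstanceAs (Module F (SuperPoly F r s ⧸ relations S r s))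

/-- The quotient map. -/
noncomputable def toFree {F : Type u} [Field F] (S : Set (NAPoly F)) (r s : ℕ) :
    SuperPoly F r s →ₗ[F] FreeCarrier S r s :=
  (relations S r s).mkQ

theorem toFree_surjective {F : Type u} [Field F] (S : Set (NAPoly F)) (r s : ℕ) :
    Function.Surjective (toFree S r s) :=
  (relations S r s).mkQ_surjective

theorem toFree_eq_zero {F : Type u} [Field F] (S : Set (NAPoly F)) (r s : ℕ)
    (p : SuperPoly F r s) : toFree S r s p = 0 ↔ p ∈ relations S r s :=
  Submodule.Quotient.mk_eq_zero _

theorem toFree_eq {F : Type u} [Field F] (S : Set (NAPoly F)) (r s : ℕ)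
    (p q : SuperPoly F r s) : toFree S r s p = toFree S r s q ↔ p - q ∈ relations S r s :=
  Submodule.Quotient.eq _

noncomputable instance {F : Type u} [Field F] (S : Set (NAPoly F)) (r s : ℕ) :
    Mul (FreeCarrier S r s) where
  mul := Quotient.map₂ (fun p q : SuperPoly F r s => p * q) (by
    intro p p' hp q q' hq
    have hp' : p - p' ∈ relations S r s := (Submodule.quotientRel_def _).1 hp
    have hq' : q - q' ∈ relations S r s := (Submodule.quotientRel_def _).1 hq
    refine (Submodule.quotientRel_def _).2 ?_
    have h : p * q - p' * q' = (p - p') * q + p' * (q - q') := by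
      rw [sub_mul, mul_sub]; abel
    rw [h]
    exact add_mem (relations_mul_right S r s hp' q) (relations_mul_left S r s hq' p'))

theorem toFree_mul {F : Type u} [Field F] (S : Set (NAPoly F)) (r s : ℕ)
    (p q : SuperPoly F r s) : toFree S r s (p * q) = toFree S r s p * toFree S r s q :=
  rfl

noncomputable instance {F : Type u} [Field F] (S : Set (NAPoly F)) (r s : ℕ) :
    NonUnitalNonAssocRing (FreeCarrier S r s) where
  left_distrib a b c := by
    obtain ⟨a, rfl⟩ := toFree_surjective S r s a
    obtain ⟨b, rfl⟩ := toFree_surjective S r s b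
    obtain ⟨c, rfl⟩ := toFree_surjective S r s c
    rw [← map_add, ← toFree_mul, mul_add, map_add, toFree_mul, toFree_mul]
  right_distrib a b c := by
    obtain ⟨a, rfl⟩ := toFree_surjective S r s a
    obtain ⟨b, rfl⟩ := toFree_surjective S r s b
    obtain ⟨c, rfl⟩ := toFree_surjective S r s c
    rw [← map_add, ← toFree_mul, add_mul, map_add, toFree_mul, toFree_mul]
  zero_mul a := by
    obtain ⟨a, rfl⟩ := toFree_surjective S r s a
    rw [← map_zero (toFree S r s), ← toFree_mul, zero_mul]
  mul_zero a := by
    obtain ⟨a, rfl⟩ := toFree_surjective S r s a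
    rw [← map_zero (toFree S r s), ← toFree_mul, mul_zero]

instance {F : Type u} [Field F] (S : Set (NAPoly F)) (r s : ℕ) :
    IsScalarTower F (FreeCarrier S r s) (FreeCarrier S r s) where
  smul_assoc c a b := by
    obtain ⟨a, rfl⟩ := toFree_surjective S r s a
    obtain ⟨b, rfl⟩ := toFree_surjective S r s b
    rw [smul_eq_mul, smul_eq_mul, ← map_smul, ← toFree_mul, smul_mul_assoc, map_smul, toFree_mul]

instance {F : Type u} [Field F] (S : Set (NAPoly F)) (r s : ℕ) :
    SMulCommClass F (FreeCarrier S r s) (FreeCarrier S r s) where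
  smul_comm c a b := by
    obtain ⟨a, rfl⟩ := toFree_surjective S r s a
    obtain ⟨b, rfl⟩ := toFree_surjective S r s b
    rw [smul_eq_mul, smul_eq_mul, ← map_smul, ← toFree_mul, ← toFree_mul, mul_smul_comm, map_smul]

theorem IsGraded.map_mem {F : Type u} [Field F] {r s : ℕ} {A : Superalgebra.{u} F}
    {φ : SuperPoly F r s →ₙₐ[F] A.carrier} (hφ : IsGraded A φ) {i : ZMod 2}
    {p : SuperPoly F r s} (hp : p ∈ superPolyPart F r s i) : φ p ∈ A.part i := by
  have key : ∀ m : FreeMagma (Fin r ⊕ Fin s),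
      φ (MonoidAlgebra.single m 1) ∈ A.part (parity m) := by
    intro m
    induction m using FreeMagma.recOnMul with
    | ih1 a =>
      cases a with
      | inl i => exact hφ.1 i
      | inr j => exact hφ.2 j
    | ih2 v w hv hw =>
      have h : (MonoidAlgebra.single (v * w) 1 : SuperPoly F r s)
          = MonoidAlgebra.single v 1 * MonoidAlgebra.single w 1 := by
        rw [MonoidAlgebra.single_mul_single, one_mul]
      change φ (MonoidAlgebra.single (v * w) 1) ∈ A.part (parity v + parity w)
      rw [h, map_mul]
      exact A.mul_mem _ _ _ _ hv hw
  induction hp using Submodule.span_induction with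
  | zero => rw [map_zero]; exact zero_mem _
  | add v w _ _ hv hw => rw [map_add]; exact add_mem hv hw
  | smul c v _ hv => rw [map_smul]; exact Submodule.smul_mem _ c hv
  | mem v hv =>
    obtain ⟨m, rfl, rfl⟩ := hv
    exact key m

theorem superPolyPart_mul {F : Type u} [Field F] {r s : ℕ} {i j : ZMod 2}
    {p q : SuperPoly F r s} (hp : p ∈ superPolyPart F r s i) (hq : q ∈ superPolyPart F r s j) :
    p * q ∈ superPolyPart F r s (i + j) := by
  induction hp using Submodule.span_induction with
  | zero => rw [zero_mul]; exact zero_mem _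
  | add v w _ _ hv hw => rw [add_mul]; exact add_mem hv hw
  | smul c v _ hv => rw [smul_mul_assoc]; exact Submodule.smul_mem _ c hv
  | mem v hv =>
    obtain ⟨m, rfl, rfl⟩ := hv
    induction hq using Submodule.span_induction with
    | zero => rw [mul_zero]; exact zero_mem _
    | add v w _ _ hv hw => rw [mul_add]; exact add_mem hv hw
    | smul c v _ hv => rw [mul_smul_comm]; exact Submodule.smul_mem _ c hv
    | mem w hw =>
      obtain ⟨n, rfl, rfl⟩ := hw
      refine Submodule.subset_span ⟨m * n, rfl, ?_⟩
      rw [MonoidAlgebra.single_mul_single, one_mul]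

theorem superPolyPart_sup (F : Type u) [Field F] (r s : ℕ) :
    superPolyPart F r s 0 ⊔ superPolyPart F r s 1 = ⊤ := by
  rw [eq_top_iff]
  rintro p -
  induction p using MonoidAlgebra.induction_linear with
  | zero => exact zero_mem _
  | add p q hp hq => exact add_mem hp hq
  | single m c =>
    have h : (MonoidAlgebra.single m c : SuperPoly F r s) = c • MonoidAlgebra.single m 1 := by
      rw [MonoidAlgebra.smul_single, smul_eq_mul, mul_one]
    rw [h]
    refine Submodule.smul_mem _ c ?_
    have h2 : ∀ i : ZMod 2, i = 0 ∨ i = 1 := by decide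
    rcases h2 (parity m) with h0 | h1
    · exact Submodule.mem_sup_left (Submodule.subset_span ⟨m, h0, rfl⟩)
    · exact Submodule.mem_sup_right (Submodule.subset_span ⟨m, h1, rfl⟩)

/-- The free `V`-superalgebra on `r` even and `s` odd generators, `V` being the variety defined
by `S`: the free superalgebra modulo all relations that hold in every `V`-superalgebra. -/
noncomputable def freeSuperalgebra {F : Type u} [Field F] (S : Set (NAPoly F)) (r s : ℕ) :
    Superalgebra.{u} F where
  carrier := FreeCarrier S r s
  part i := (superPolyPart F r s i).map (toFree S r s)
  isCompl := by
    constructor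
    · rw [Submodule.disjoint_def]
      rintro a ⟨p, hp, rfl⟩ ⟨q, hq, hqp⟩
      have hpq : q - p ∈ relations S r s := (toFree_eq S r s q p).1 hqp
      refine (toFree_eq_zero S r s p).2 fun A hA φ hφ => ?_
      have h1 : φ q = φ p := by
        rw [← sub_eq_zero, ← map_sub]; exact hpq A hA φ hφ
      have h2 : φ p ∈ A.part 1 := h1 ▸ hφ.map_mem hq
      exact (Submodule.disjoint_def.1 A.isCompl.disjoint) _ (hφ.map_mem hp) h2
    · rw [codisjoint_iff, ← Submodule.map_sup, superPolyPart_sup, Submodule.map_top]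
      exact LinearMap.range_eq_top.2 (toFree_surjective S r s)
  mul_mem := by
    rintro i j _ _ ⟨p, hp, rfl⟩ ⟨q, hq, rfl⟩
    exact ⟨p * q, superPolyPart_mul hp hq, toFree_mul S r s p q⟩

/-- The supervariety `V_{r,s}` generated by the free `V`-superalgebra on `r` even and `s` odd
generators. For `r = s = 0` the free superalgebra is zero, so `V_{0,0}` consists of the zero
superalgebras. -/
def generatedByFree {F : Type u} [Field F] (S : Set (NAPoly F)) (r s : ℕ) :
    Set (Superalgebra.{u} F) :=
  generatedBy (freeSuperalgebra S r s)

/-- The basic superrank of the variety `V` defined by `S` is infinite: for no `r, s` does the free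
`V`-superalgebra on `r` even and `s` odd generators generate the supervariety of all
`V`-superalgebras. -/
def HasInfiniteBasicSuperrank {F : Type u} [Field F] (S : Set (NAPoly F)) : Prop :=
  ∀ r s : ℕ, generatedByFree S r s ≠ superVariety S

/-! ### The varieties `V^⟨ε⟩` -/

/-- `⟨a, b⟩_ε = ab - ε ba`. -/
noncomputable def epsBracket {F : Type u} [Field F] (ε : F) (a b : NAPoly F) : NAPoly F :=
  a * b - ε • (b * a)

/-- The defining identities of `V^⟨ε⟩`: metability `(xy)(zt) = 0`, `(x,y,z) = ε (x,z,y)` for the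
associator `(x,y,z) = (xy)z - x(yz)`, and `⟨⟨x,y⟩_ε,z⟩_ε = 0`. -/
noncomputable def epsIdentities {F : Type u} [Field F] (ε : F) : Set (NAPoly F) :=
  {(x F 0 * x F 1) * (x F 2 * x F 3),
   associator (x F 0) (x F 1) (x F 2) - ε • associator (x F 0) (x F 2) (x F 1),
   epsBracket ε (epsBracket ε (x F 0) (x F 1)) (x F 2)}

end Superrank

/-! The argument compares growth: a multilinear identity with many free coefficients holds in every
finitely generated free superalgebra, yet fails in one purely even algebra of the variety.

Consider combinations `∑ c σ • b₀(a_{σ 0}(b₁(a_{σ 1}(⋯(x₀x₁)))))` over permutations `σ` of `m`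
letters (`interleavePoly`). In a metabelian algebra all letters act on the square `x₀x₁`, and a
letter lying in the square acts as zero. Hence in the Grassmann envelope of the free superalgebra
only substitutions of the form (Grassmann element) ⊗ (generator) matter. Once generators are
assigned to the letters, two permutations that produce the same sequence of generators give the same
word up to a sign depending only on the parities. The identity therefore follows from at most
`(r+s)^(2m) * (r+s)^m` linear conditions on the `m!` coefficients. A factorial outgrows every
exponential, so for large `m` a nonzero `c` satisfies them all
(`exists_superSatisfies_interleavePoly`).

For the failure, `ModelAlgebra` is a split null extension in which each pair of left multiplications
by `bᵢ` and `a_{σ i}` multiplies one module slot by a free generator `t_{σ i}`. Different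
permutations yield different words of the free monoid, so the values are linearly independent and no
nonzero `c` gives an identity (`not_superSatisfies_interleavePoly`). With all its elements even,
this algebra is a superalgebra of the variety (`modelSuperalgebra_mem_superVariety`). -/

namespace Superrank

/-! ### Iterated left multiplications -/

/-- The product `z i₁ * (z i₂ * (⋯ * (z iₙ * y)))` for the list `l = [i₁, …, iₙ]`. -/
def leftWord {ι M : Type*} [Mul M] (z : ι → M) (y : M) (l : List ι) : M :=
  l.foldr (fun i w => z i * w) y

section LeftWord

variable {ι M N : Type*}

@[simp] theorem leftWord_nil [Mul M] (z : ι → M) (y : M) : leftWord z y [] = y := rfl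

@[simp] theorem leftWord_cons [Mul M] (z : ι → M) (y : M) (i : ι) (l : List ι) :
    leftWord z y (i :: l) = z i * leftWord z y l := rfl

theorem leftWord_append [Mul M] (z : ι → M) (y : M) (l l' : List ι) :
    leftWord z y (l ++ l') = leftWord z (leftWord z y l') l :=
  List.foldr_append

theorem map_leftWord {H : Type*} [Mul M] [Mul N] [FunLike H M N] [MulHomClass H M N] (φ : H)
    (z : ι → M) (y : M) (l : List ι) :
    φ (leftWord z y l) = leftWord (fun i => φ (z i)) (φ y) l := by
  induction l with
  | nil => rfl
  | cons i l ih => rw [leftWord_cons, leftWord_cons, map_mul, ih]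

theorem leftWord_congr [Mul M] {z z' : ι → M} (y : M) {l : List ι} (h : ∀ i ∈ l, z i = z' i) :
    leftWord z y l = leftWord z' y l := by
  induction l with
  | nil => rfl
  | cons i l ih =>
    rw [leftWord_cons, leftWord_cons, h i List.mem_cons_self,
      ih fun j hj => h j (List.mem_cons_of_mem _ hj)]

theorem leftWord_zero [NonUnitalNonAssocSemiring M] (z : ι → M) (l : List ι) :
    leftWord z 0 l = 0 := by
  induction l with
  | nil => rfl
  | cons i l ih => rw [leftWord_cons, ih, mul_zero]

/-- A word in which every letter occurs once depends linearly on each letter. -/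
theorem exists_linear_leftWord (R : Type*) [CommSemiring R] [NonUnitalNonAssocSemiring M]
    [Module R M] [IsScalarTower R M M] [SMulCommClass R M M] [DecidableEq ι] (z : ι → M) (y : M)
    {l : List ι} (hl : l.Nodup) {i : ι} (hi : i ∈ l) :
    ∃ ℓ : M →ₗ[R] M, ∀ a, leftWord (Function.update z i a) y l = ℓ a := by
  induction l with
  | nil => simp at hi
  | cons k l ih =>
    rw [List.nodup_cons] at hl
    by_cases hik : i = k
    · subst hik
      refine ⟨LinearMap.mulRight R (leftWord z y l), fun a => ?_⟩
      rw [leftWord_cons, Function.update_self, LinearMap.mulRight_apply]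
      congr 1
      refine leftWord_congr y fun j hj => Function.update_of_ne ?_ _ _
      rintro rfl
      exact hl.1 hj
    · obtain ⟨ℓ, hℓ⟩ := ih hl.2 ((List.mem_cons.1 hi).resolve_left hik)
      refine ⟨LinearMap.mulLeft R (z k) ∘ₗ ℓ, fun a => ?_⟩
      rw [leftWord_cons, Function.update_of_ne (Ne.symm hik), hℓ]
      rfl

end LeftWord

/-- A map of several variables that is linear in each of them vanishes on the span of a set if it
vanishes on the set. -/
theorem eq_zero_of_mem_span {R ι M N : Type*} [CommSemiring R] [AddCommMonoid M] [Module R M]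
    [AddCommMonoid N] [Module R N] [Fintype ι] [DecidableEq ι] (Φ : (ι → M) → N)
    (hΦ : ∀ x i, ∃ ℓ : M →ₗ[R] N, ∀ a, Φ (Function.update x i a) = ℓ a) (S : Set M)
    (h0 : ∀ x, (∀ i, x i ∈ S) → Φ x = 0) (x : ι → M) (hx : ∀ i, x i ∈ Submodule.span R S) :
    Φ x = 0 := by
  -- Coordinates are released from `S` to its span one at a time; `t` is the set of those already
  -- released.
  have key : ∀ (t : Finset ι) (x : ι → M), (∀ i ∈ t, x i ∈ Submodule.span R S) →
      (∀ i ∉ t, x i ∈ S) → Φ x = 0 := by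
    intro t
    induction t using Finset.induction_on with
    | empty => exact fun x _ h => h0 x fun i => h i (Finset.notMem_empty i)
    | insert i t hit ih =>
      intro x h1 h2
      obtain ⟨ℓ, hℓ⟩ := hΦ x i
      have h3 : Set.EqOn ℓ (0 : M →ₗ[R] N) S := by
        intro a ha
        rw [← hℓ, LinearMap.zero_apply]
        refine ih _ (fun j hj => ?_) fun j hj => ?_
        · rw [Function.update_of_ne (ne_of_mem_of_not_mem hj hit)]
          exact h1 j (Finset.mem_insert_of_mem hj)
        · by_cases hji : j = i
          · subst hji; rwa [Function.update_self]
          · rw [Function.update_of_ne hji]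
            exact h2 j fun h => (Finset.mem_insert.1 h).elim hji hj
      have h4 := LinearMap.eqOn_span h3 (h1 i (Finset.mem_insert_self i t))
      rwa [← hℓ, Function.update_eq_self, LinearMap.zero_apply] at h4
  exact key Finset.univ x (fun i _ => hx i) fun i hi => absurd (Finset.mem_univ i) hi

/-! ### The interleaved words -/

section Interleave

variable {m : ℕ}

/-- The list `b₀, a_{σ 0}, b₁, a_{σ 1}, …`, where `aᵢ = Sum.inl i` and `bᵢ = Sum.inr i`. -/
def interleave (σ : Equiv.Perm (Fin m)) : List (Fin m ⊕ Fin m) :=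
  (List.finRange m).flatMap fun i => [Sum.inr i, Sum.inl (σ i)]

theorem mem_interleave (σ : Equiv.Perm (Fin m)) (i : Fin m ⊕ Fin m) : i ∈ interleave σ := by
  rw [interleave, List.mem_flatMap]
  cases i with
  | inl i => exact ⟨σ.symm i, List.mem_finRange _, by simp⟩
  | inr i => exact ⟨i, List.mem_finRange _, by simp⟩

theorem nodup_interleave (σ : Equiv.Perm (Fin m)) : (interleave σ).Nodup := by
  rw [interleave, List.nodup_flatMap]
  refine ⟨fun i _ => by simp, (List.nodup_finRange m).imp fun {i j} hij => ?_⟩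
  simp [Function.onFun, hij.symm]

theorem interleave_perm (σ τ : Equiv.Perm (Fin m)) : (interleave σ).Perm (interleave τ) :=
  (List.perm_ext_iff_of_nodup (nodup_interleave σ) (nodup_interleave τ)).2 fun i =>
    iff_of_true (mem_interleave σ i) (mem_interleave τ i)

theorem map_interleave {γ : Type*} (σ : Equiv.Perm (Fin m)) (j : Fin m ⊕ Fin m → γ) :
    (interleave σ).map j =
      (List.finRange m).flatMap fun i => [j (Sum.inr i), j (Sum.inl (σ i))] := by
  simp [interleave, List.map_flatMap]

/-- The variables `x 0` and `x 1` being set apart, the remaining ones are numbered by two copies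
of `Fin m`. -/
def varIndex : Fin m ⊕ Fin m → ℕ :=
  Sum.elim (fun i => 2 * i + 2) (fun i => 2 * i + 3)

theorem varIndex_injective : Function.Injective (varIndex (m := m)) := by
  rintro (i | i) (j | j) h <;> simp only [varIndex, Sum.elim_inl, Sum.elim_inr] at h
  · exact congrArg _ (Fin.ext (by omega))
  · omega
  · omega
  · exact congrArg _ (Fin.ext (by omega))

theorem two_le_varIndex (i : Fin m ⊕ Fin m) : 2 ≤ varIndex i := by
  rcases i with i | i <;> simp [varIndex]

/-- The multilinear polynomial `∑ c σ • b₀ (a_{σ 0} (b₁ (a_{σ 1} (⋯ (x₀ x₁)))))`. -/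
noncomputable def interleavePoly {F : Type u} [Field F] (c : Equiv.Perm (Fin m) → F) : NAPoly F :=
  ∑ σ, c σ • leftWord (fun i => x F (varIndex i)) (x F 0 * x F 1) (interleave σ)

theorem lift_interleavePoly {F : Type u} [Field F] (c : Equiv.Perm (Fin m) → F) {A : Type u}
    [NonUnitalNonAssocRing A] [Module F A] [IsScalarTower F A A] [SMulCommClass F A A]
    (a : ℕ → A) :
    FreeNonUnitalNonAssocAlgebra.lift F a (interleavePoly c) =
      ∑ σ, c σ • leftWord (fun i => a (varIndex i)) (a 0 * a 1) (interleave σ) := by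
  simp only [interleavePoly, map_sum, map_smul, map_leftWord, map_mul, x,
    FreeNonUnitalNonAssocAlgebra.lift_of_apply]

theorem letters_leftWord {ι X : Type*} (z : ι → X) (y : FreeMagma X) (l : List ι) :
    letters (leftWord (fun i => FreeMagma.of (z i)) y l) = (l.map z : Multiset X) + letters y := by
  induction l with
  | nil => simp
  | cons i l ih =>
    rw [leftWord_cons]
    change {z i} + letters _ = _
    rw [ih, ← add_assoc]
    rfl

theorem isMultilinear_interleavePoly {F : Type u} [Field F] (c : Equiv.Perm (Fin m) → F) :
    IsMultilinear (interleavePoly c) := by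
  have hnd : (((interleave (1 : Equiv.Perm (Fin m))).map varIndex : Multiset ℕ)
      + {0} + {1}).Nodup := by
    rw [Multiset.nodup_add, Multiset.nodup_add]
    have h2 : ∀ k < 2, k ∉ (interleave (1 : Equiv.Perm (Fin m))).map varIndex := by
      intro k hk h
      obtain ⟨i, -, rfl⟩ := List.mem_map.1 h
      exact absurd (two_le_varIndex i) (by omega)
    refine ⟨⟨?_, by simp, ?_⟩, by simp, ?_⟩
    · exact Multiset.coe_nodup.2 ((nodup_interleave 1).map varIndex_injective)
    · simpa using h2 0 (by omega)
    · simpa using h2 1 (by omega)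
  refine ⟨⟨_, hnd⟩, fun w hw => ?_⟩
  have hw' : ∃ σ : Equiv.Perm (Fin m), w = leftWord (fun i => FreeMagma.of (varIndex i))
      (FreeMagma.of 0 * FreeMagma.of 1) (interleave σ) := by
    -- A monomial different from all the interleaved words has coefficient zero.
    by_contra! hne
    refine Finsupp.mem_support_iff.1 hw ?_
    rw [interleavePoly, MonoidAlgebra.coeff_sum, Finsupp.finsetSum_apply]
    refine Finset.sum_eq_zero fun σ _ => ?_
    have h : leftWord (fun i => x F (varIndex i)) (x F 0 * x F 1) (interleave σ) =
        MonoidAlgebra.ofMagma F (FreeMagma ℕ) (leftWord (fun i => FreeMagma.of (varIndex i))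
          (FreeMagma.of 0 * FreeMagma.of 1) (interleave σ)) := by
      rw [map_leftWord, map_mul]; rfl
    rw [h, MonoidAlgebra.coeff_smul_apply]
    change c σ • (MonoidAlgebra.single _ (1 : F)).coeff w = 0
    rw [MonoidAlgebra.coeff_single, Finsupp.single_eq_of_ne (hne σ), smul_zero]
  obtain ⟨σ, rfl⟩ := hw'
  rw [letters_leftWord]
  change _ + ({0} + {1}) = _
  rw [← add_assoc, Multiset.coe_eq_coe.2 ((interleave_perm σ 1).map varIndex)]

end Interleave

/-! ### Signs in the Grassmann algebra -/

section Grassmann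

variable {F : Type u} [Field F]

/-- For the zero quadratic form any two vectors are orthogonal, so the Clifford sign rule for
orthogonal images applies with both isometries the identity. -/
theorem grassmann_mul_comm {i j : ZMod 2} {g h : Grassmann F} (hg : g ∈ grassmannPart F i)
    (hh : h ∈ grassmannPart F j) : g * h = (-1 : F) ^ (j * i).val • (h * g) := by
  have key := CliffordAlgebra.map_mul_map_of_isOrtho_of_mem_evenOdd
    (QuadraticMap.Isometry.id (0 : QuadraticForm F (ℕ →₀ F)))
    (QuadraticMap.Isometry.id (0 : QuadraticForm F (ℕ →₀ F)))
    (fun a b => by simp [QuadraticMap.IsOrtho]) g h hg hh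
  simp only [CliffordAlgebra.map_id, AlgHom.id_apply] at key
  rw [key]
  have h2 : ∀ i : ZMod 2, i = 0 ∨ i = 1 := by decide
  rcases h2 (j * i) with h | h <;> rw [h] <;> simp [ZMod.val_one, Units.smul_def]

/-- The product of homogeneous elements of given parities, taken in another order, changes by a
scalar that depends only on the parities. -/
theorem exists_sign_prod_perm {ι : Type*} (p : ι → ZMod 2) {l l' : List ι} (h : l.Perm l') :
    ∃ s : F, ∀ g : ι → Grassmann F, (∀ i, g i ∈ grassmannPart F (p i)) →
      (l.map g).prod = s • (l'.map g).prod := by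
  induction h with
  | nil => exact ⟨1, fun g _ => (one_smul F _).symm⟩
  | cons i _ ih =>
    obtain ⟨s, hs⟩ := ih
    exact ⟨s, fun g hg => by
      rw [List.map_cons, List.prod_cons, List.map_cons, List.prod_cons, hs g hg, mul_smul_comm]⟩
  | swap i j l =>
    refine ⟨(-1) ^ (p i * p j).val, fun g hg => ?_⟩
    simp only [List.map_cons, List.prod_cons]
    rw [← mul_assoc, grassmann_mul_comm (hg j) (hg i), smul_mul_assoc, mul_assoc]
  | trans _ _ ih ih' =>
    obtain ⟨s, hs⟩ := ih
    obtain ⟨s', hs'⟩ := ih'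
    exact ⟨s * s', fun g hg => by rw [hs g hg, hs' g hg, smul_smul]⟩

/-- The generators of the Grassmann algebra. -/
noncomputable def grassmannGen (F : Type u) [Field F] (n : ℕ) : Grassmann F :=
  ExteriorAlgebra.ι F (Finsupp.single n 1)

theorem contractLeft_prod_grassmannGen (n : ℕ) {l : List ℕ} (hn : n ∉ l) :
    CliffordAlgebra.contractLeft (Q := (0 : QuadraticForm F (ℕ →₀ F)))
      (Finsupp.lapply n : (ℕ →₀ F) →ₗ[F] F) (l.map (grassmannGen F)).prod = 0 := by
  induction l with
  | nil => exact CliffordAlgebra.contractLeft_one (Q := (0 : QuadraticForm F (ℕ →₀ F))) _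
  | cons k l ih =>
    rw [List.mem_cons, not_or] at hn
    rw [List.map_cons, List.prod_cons, grassmannGen]
    refine (CliffordAlgebra.contractLeft_ι_mul _ _ _).trans ?_
    rw [ih hn.2, Finsupp.lapply_apply, Finsupp.single_eq_of_ne hn.1, zero_smul, mul_zero, sub_zero]

/-- Contraction with the coordinate functional of the first generator strips that generator off,
since it kills the product of the others. -/
theorem prod_grassmannGen_ne_zero {l : List ℕ} (hl : l.Nodup) :
    (l.map (grassmannGen F)).prod ≠ 0 := by
  induction l with
  | nil => exact one_ne_zero
  | cons k l ih =>
    rw [List.nodup_cons] at hl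
    intro h
    refine ih hl.2 ?_
    have h1 := CliffordAlgebra.contractLeft_ι_mul (Q := (0 : QuadraticForm F (ℕ →₀ F)))
      (Finsupp.lapply k : (ℕ →₀ F) →ₗ[F] F) (Finsupp.single k 1) (l.map (grassmannGen F)).prod
    rw [contractLeft_prod_grassmannGen k hl.1, mul_zero, sub_zero, Finsupp.lapply_apply,
      Finsupp.single_eq_same, one_smul] at h1
    rw [← h1]
    rw [List.map_cons, List.prod_cons, grassmannGen] at h
    exact (congrArg _ h).trans (map_zero _)

end Grassmann

/-! ### Metabelian superalgebras -/

section Metabelian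

variable {F : Type u} [Field F]

theorem Superalgebra.induction_part (A : Superalgebra.{u} F) {P : A.carrier → Prop}
    (part : ∀ i, ∀ a ∈ A.part i, P a) (add : ∀ a b, P a → P b → P (a + b)) (a : A.carrier) :
    P a := by
  have ha : a ∈ A.part 0 ⊔ A.part 1 := A.isCompl.sup_eq_top ▸ Submodule.mem_top
  obtain ⟨b, hb, c, hc, rfl⟩ := Submodule.mem_sup.1 ha
  exact add _ _ (part 0 b hb) (part 1 c hc)

theorem eq_zero_of_tmul_eq_zero {G B : Type*} [AddCommGroup G] [Module F G] [AddCommGroup B]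
    [Module F B] {g : G} (hg : g ≠ 0) {b : B} (h : g ⊗ₜ[F] b = 0) : b = 0 := by
  have hξ : ∃ ξ : Module.Dual F G, ξ g ≠ 0 := by
    by_contra! h0
    exact hg ((Module.forall_dual_apply_eq_zero_iff F g).1 h0)
  obtain ⟨ξ, hξ⟩ := hξ
  have h' := congrArg ((TensorProduct.lid F B).toLinearMap ∘ₗ ξ.rTensor B) h
  simp only [map_zero, LinearMap.comp_apply, LinearEquiv.coe_coe, LinearMap.rTensor_tmul,
    TensorProduct.lid_tmul] at h'
  exact (smul_eq_zero.1 h').resolve_left hξ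

theorem tmul_mem_envelope {A : Superalgebra.{u} F} {i : ZMod 2} {g : Grassmann F}
    (hg : g ∈ grassmannPart F i) {a : A.carrier} (ha : a ∈ A.part i) :
    g ⊗ₜ[F] a ∈ envelope A :=
  Submodule.subset_span ⟨i, g, hg, a, ha, rfl⟩

/-- A superalgebra whose Grassmann envelope is metabelian is metabelian. -/
theorem mul_mul_mul_eq_zero_of_superSatisfies {A : Superalgebra.{u} F}
    (hA : SuperSatisfies ((x F 0 * x F 1) * (x F 2 * x F 3)) A) (a b c d : A.carrier) :
    (a * b) * (c * d) = 0 := by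
  -- Even elements are paired with `1` and odd ones with a Grassmann generator of their own, so that
  -- the product of the four coefficients is nonzero and can be cancelled.
  let word : ZMod 2 → ℕ → List ℕ := fun i n => if i = 0 then [] else [n]
  have hnd : ∀ i j k l, (word i 0 ++ word j 1 ++ word k 2 ++ word l 3).Nodup := by decide
  have hmem : ∀ i n, ((word i n).map (grassmannGen F)).prod ∈ grassmannPart F i := by
    intro i n
    have h2 : i = 0 ∨ i = 1 := by revert i; decide
    rcases h2 with rfl | rfl
    · exact SetLike.GradedOne.one_mem
    · have h1 : ((word 1 n).map (grassmannGen F)).prod = grassmannGen F n := by simp [word]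
      rw [h1]
      exact CliffordAlgebra.ι_mem_evenOdd_one _ _
  have key : ∀ i, ∀ a ∈ A.part i, ∀ j, ∀ b ∈ A.part j, ∀ k, ∀ c ∈ A.part k,
      ∀ l, ∀ d ∈ A.part l, (a * b) * (c * d) = 0 := by
    intro i a ha j b hb k c hc l d hd
    have h := hA fun n => match n with
      | 0 => ⟨_, tmul_mem_envelope (hmem i 0) ha⟩
      | 1 => ⟨_, tmul_mem_envelope (hmem j 1) hb⟩
      | 2 => ⟨_, tmul_mem_envelope (hmem k 2) hc⟩
      | _ => ⟨_, tmul_mem_envelope (hmem l 3) hd⟩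
    simp only [map_mul, x, FreeNonUnitalNonAssocAlgebra.lift_of_apply] at h
    have h' := congrArg Subtype.val h
    simp only [NonUnitalSubalgebra.coe_mul, Algebra.TensorProduct.tmul_mul_tmul] at h'
    rw [← mul_assoc, ← List.prod_append, ← List.map_append, ← List.prod_append, ← List.map_append,
      ← List.prod_append, ← List.map_append] at h'
    exact eq_zero_of_tmul_eq_zero (prod_grassmannGen_ne_zero (hnd i j k l)) h'
  induction a using A.induction_part with
  | add a a' h h' => rw [add_mul, add_mul, h, h', add_zero]
  | part i a ha =>
  induction b using A.induction_part with
  | add b b' h h' => rw [mul_add, add_mul, h, h', add_zero]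
  | part j b hb =>
  induction c using A.induction_part with
  | add c c' h h' => rw [add_mul, mul_add, h, h', add_zero]
  | part k c hc =>
  induction d using A.induction_part with
  | add d d' h h' => rw [mul_add, mul_add, h, h', add_zero]
  | part l d hd => exact key i a ha j b hb k c hc l d hd

theorem freeCarrier_metabelian {S : Set (NAPoly F)} (hS : (x F 0 * x F 1) * (x F 2 * x F 3) ∈ S)
    (r s : ℕ) (a b c d : FreeCarrier S r s) : (a * b) * (c * d) = 0 := by
  obtain ⟨a, rfl⟩ := toFree_surjective S r s a
  obtain ⟨b, rfl⟩ := toFree_surjective S r s b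
  obtain ⟨c, rfl⟩ := toFree_surjective S r s c
  obtain ⟨d, rfl⟩ := toFree_surjective S r s d
  rw [← toFree_mul, ← toFree_mul, ← toFree_mul, toFree_eq_zero]
  intro A hA φ _
  rw [map_mul, map_mul, map_mul]
  exact mul_mul_mul_eq_zero_of_superSatisfies (hA _ hS) _ _ _ _

end Metabelian

/-! ### Words in a tensor product -/

section Tensor

variable {F G B ι : Type*} [Field F] [Ring G] [Algebra F G] [NonUnitalNonAssocRing B] [Module F B]
  [IsScalarTower F B B] [SMulCommClass F B B]

/-- This separates the Grassmann coefficient, which only contributes a sign under reordering, from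
the composite of left multiplications. It is phrased with operators because `y` need not be a pure
tensor. -/
theorem leftWord_tmul (g : ι → G) (w : ι → B) (y : G ⊗[F] B) (l : List ι) :
    leftWord (fun i => g i ⊗ₜ[F] w i) y l =
      TensorProduct.map (LinearMap.mulLeft F (l.map g).prod)
        (l.map fun i => (LinearMap.mulLeft F (w i) : Module.End F B)).prod y := by
  induction l with
  | nil =>
    simp only [leftWord_nil, List.map_nil, List.prod_nil, LinearMap.mulLeft_one]
    exact (LinearMap.congr_fun TensorProduct.map_id y).symm
  | cons i l ih =>
    have hmul : ∀ t : G ⊗[F] B, g i ⊗ₜ[F] w i * t =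
        TensorProduct.map (LinearMap.mulLeft F (g i)) (LinearMap.mulLeft F (w i)) t := by
      intro t
      induction t using TensorProduct.induction_on with
      | zero => simp
      | tmul h b => simp
      | add t t' h h' => rw [mul_add, h, h', map_add]
    rw [leftWord_cons, ih, hmul, List.map_cons, List.map_cons, List.prod_cons, List.prod_cons,
      LinearMap.mulLeft_mul, Module.End.mul_eq_comp, TensorProduct.map_comp]
    rfl

/-- The tensors `g ⊗ b c`. -/
def squareTensors (F G B : Type*) [Field F] [Ring G] [Algebra F G] [NonUnitalNonAssocRing B]
    [Module F B] : Set (G ⊗[F] B) :=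
  {t | ∃ (g : G) (b c : B), t = g ⊗ₜ[F] (b * c)}

theorem mul_mem_span_squareTensors (t t' : G ⊗[F] B) :
    t * t' ∈ Submodule.span F (squareTensors F G B) := by
  induction t using TensorProduct.induction_on with
  | zero => rw [zero_mul]; exact zero_mem _
  | add t u h h' => rw [add_mul]; exact add_mem h h'
  | tmul g b =>
    induction t' using TensorProduct.induction_on with
    | zero => rw [mul_zero]; exact zero_mem _
    | add t u h h' => rw [mul_add]; exact add_mem h h'
    | tmul h c =>
      rw [Algebra.TensorProduct.tmul_mul_tmul]
      exact Submodule.subset_span ⟨_, _, _, rfl⟩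

theorem mul_eq_zero_of_mem_squareTensors (hB : ∀ a b c d : B, (a * b) * (c * d) = 0)
    {t t' : G ⊗[F] B} (ht : t ∈ squareTensors F G B)
    (ht' : t' ∈ Submodule.span F (squareTensors F G B)) : t * t' = 0 := by
  obtain ⟨g, a, b, rfl⟩ := ht
  induction ht' using Submodule.span_induction with
  | zero => rw [mul_zero]
  | add u v _ _ hu hv => rw [mul_add, hu, hv, add_zero]
  | smul c u _ hu => rw [mul_smul_comm, hu, smul_zero]
  | mem u hu =>
    obtain ⟨h, c, d, rfl⟩ := hu
    rw [Algebra.TensorProduct.tmul_mul_tmul, hB, TensorProduct.tmul_zero]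

theorem tensor_mul_mul_mul_eq_zero (hB : ∀ a b c d : B, (a * b) * (c * d) = 0)
    (t t' u u' : G ⊗[F] B) : (t * t') * (u * u') = 0 := by
  have h : Set.EqOn (LinearMap.mulRight F (u * u'))
      (0 : G ⊗[F] B →ₗ[F] G ⊗[F] B) (squareTensors F G B) := fun v hv =>
    mul_eq_zero_of_mem_squareTensors hB hv (mul_mem_span_squareTensors u u')
  exact LinearMap.eqOn_span h (mul_mem_span_squareTensors t t')

theorem leftWord_eq_zero_of_mem_squareTensors (hB : ∀ a b c d : B, (a * b) * (c * d) = 0)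
    (z : ι → G ⊗[F] B) {y : G ⊗[F] B} (hy : y ∈ Submodule.span F (squareTensors F G B))
    {l : List ι} {i : ι} (hi : i ∈ l) (hz : z i ∈ squareTensors F G B) : leftWord z y l = 0 := by
  obtain ⟨l₁, l₂, rfl⟩ := List.append_of_mem hi
  rw [leftWord_append, leftWord_cons, mul_eq_zero_of_mem_squareTensors hB hz, leftWord_zero]
  -- The part of the word to the right of the vanishing letter is either `y` itself or a product,
  -- and lies in the span of the squares in both cases.
  cases l₂ with
  | nil => exact hy
  | cons k l₂ => exact mul_mem_span_squareTensors _ _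

end Tensor

/-! ### Superidentities of finitely generated free superalgebras -/

section FreeSuperalgebra

variable {F : Type u} [Field F] {m r s : ℕ}

/-- The sign that the reordering of `interleave σ` into `interleave 1` produces for letters of
parities `p`. -/
noncomputable def interleaveSign (F : Type u) [Field F] (p : Fin m ⊕ Fin m → ZMod 2)
    (σ : Equiv.Perm (Fin m)) : F :=
  (exists_sign_prod_perm (F := F) p (interleave_perm σ 1)).choose

theorem prod_interleave (p : Fin m ⊕ Fin m → ZMod 2) (σ : Equiv.Perm (Fin m))
    {g : Fin m ⊕ Fin m → Grassmann F} (hg : ∀ i, g i ∈ grassmannPart F (p i)) :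
    ((interleave σ).map g).prod = interleaveSign F p σ • ((interleave 1).map g).prod :=
  (exists_sign_prod_perm (F := F) p (interleave_perm σ 1)).choose_spec g hg

/-- The tensors `g ⊗ v`, where `v` is a generator of the free superalgebra and `g` has the parity
of `v`. -/
def generatorTensors (S : Set (NAPoly F)) (r s : ℕ) : Set (Grassmann F ⊗[F] FreeCarrier S r s) :=
  {t | ∃ j : Fin r ⊕ Fin s, ∃ g ∈ grassmannPart F (parity (FreeMagma.of j)),
    t = g ⊗ₜ[F] toFree S r s (FreeNonUnitalNonAssocAlgebra.of F j)}

/-- A monomial is either a single generator or a product. -/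
theorem mem_span_of_mem_envelope (S : Set (NAPoly F))
    {t : Grassmann F ⊗[F] FreeCarrier S r s} (ht : t ∈ envelope (freeSuperalgebra S r s)) :
    t ∈ Submodule.span F (generatorTensors S r s ∪
      squareTensors F (Grassmann F) (FreeCarrier S r s)) := by
  refine Submodule.span_le.2 ?_ ht
  rintro _ ⟨i, g, hg, _, ⟨p, hp, rfl⟩, rfl⟩
  change g ⊗ₜ[F] toFree S r s p ∈ Submodule.span F _
  induction hp using Submodule.span_induction with
  | zero => rw [map_zero, TensorProduct.tmul_zero]; exact zero_mem _
  | add u v _ _ hu hv => rw [map_add, TensorProduct.tmul_add]; exact add_mem hu hv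
  | smul c u _ hu => rw [map_smul, TensorProduct.tmul_smul]; exact Submodule.smul_mem _ c hu
  | mem u hu =>
    obtain ⟨w, rfl, rfl⟩ := hu
    cases w with
    | of j => exact Submodule.subset_span (Or.inl ⟨j, g, hg, rfl⟩)
    | mul v w =>
      refine Submodule.subset_span (Or.inr ⟨g, toFree S r s (MonoidAlgebra.single v 1),
        toFree S r s (MonoidAlgebra.single w 1), ?_⟩)
      rw [← toFree_mul, MonoidAlgebra.single_mul_single, one_mul]
      rfl

/-- Here `j` assigns generators to the letters and `k` is the resulting sequence at the
`a`-positions. Permutations with the same `k` give proportional values, so it suffices that the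
signed coefficients cancel on each fibre. -/
theorem superSatisfies_interleavePoly {S : Set (NAPoly F)}
    (hS : (x F 0 * x F 1) * (x F 2 * x F 3) ∈ S) (c : Equiv.Perm (Fin m) → F)
    (hc : ∀ (j : Fin m ⊕ Fin m → Fin r ⊕ Fin s) (k : Fin m → Fin r ⊕ Fin s),
      ∑ σ : Equiv.Perm (Fin m) with (fun i => j (Sum.inl (σ i))) = k,
        c σ * interleaveSign F (fun i => parity (FreeMagma.of (j i))) σ = 0) :
    SuperSatisfies (interleavePoly c) (freeSuperalgebra S r s) := by
  intro a
  refine (lift_interleavePoly c a).trans ?_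
  refine Subtype.ext ?_
  let B := FreeCarrier S r s
  let sub := NonUnitalSubalgebraClass.subtype (envelope (freeSuperalgebra S r s))
  change sub _ = sub 0
  rw [map_zero, map_sum]
  simp only [map_smul, map_leftWord, map_mul]
  set y : Grassmann F ⊗[F] B := sub (a 0) * sub (a 1) with hy_def
  have hy : y ∈ Submodule.span F (squareTensors F (Grassmann F) B) :=
    mul_mem_span_squareTensors _ _
  clear_value y
  have hB := freeCarrier_metabelian hS r s
  refine eq_zero_of_mem_span (R := F) (M := Grassmann F ⊗[F] B)
    (fun z : Fin m ⊕ Fin m → Grassmann F ⊗[F] B => ∑ σ, c σ • leftWord z y (interleave σ))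
    ?_ (generatorTensors S r s ∪ squareTensors F (Grassmann F) B) ?_
    (fun i => sub (a (varIndex i))) fun i => mem_span_of_mem_envelope S (a (varIndex i)).2
  · intro z i
    choose ℓ hℓ using fun σ => exists_linear_leftWord F z y (nodup_interleave σ)
      (mem_interleave σ i)
    exact ⟨∑ σ, c σ • ℓ σ, fun b => by simp [hℓ]⟩
  · intro z hz
    -- A single letter in the square kills every word; otherwise all letters are generator tensors.
    by_cases hsq : ∃ i, z i ∈ squareTensors F (Grassmann F) B
    · obtain ⟨i, hi⟩ := hsq
      refine Finset.sum_eq_zero fun σ _ => ?_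
      rw [leftWord_eq_zero_of_mem_squareTensors hB z hy (mem_interleave σ i) hi, smul_zero]
    · rw [not_exists] at hsq
      choose j g hg hzg using fun i => (hz i).resolve_right (hsq i)
      obtain rfl : z = fun i => g i ⊗ₜ[F] toFree S r s (FreeNonUnitalNonAssocAlgebra.of F (j i)) :=
        funext hzg
      let op : Fin r ⊕ Fin s → Module.End F B := fun k =>
        LinearMap.mulLeft F (toFree S r s (FreeNonUnitalNonAssocAlgebra.of F k))
      -- The common value of a fibre, with the Grassmann coefficients in the order of the identity
      -- permutation.
      let val : (Fin m → Fin r ⊕ Fin s) → Grassmann F ⊗[F] B := fun k =>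
        TensorProduct.map (LinearMap.mulLeft F ((interleave 1).map g).prod)
          (((List.finRange m).flatMap fun i => [j (Sum.inr i), k i]).map op).prod y
      have hval : ∀ σ : Equiv.Perm (Fin m),
          c σ • leftWord (fun i => g i ⊗ₜ[F] toFree S r s
            (FreeNonUnitalNonAssocAlgebra.of F (j i))) y (interleave σ) =
          (c σ * interleaveSign F (fun i => parity (FreeMagma.of (j i))) σ) •
            val (fun i => j (Sum.inl (σ i))) := by
        intro σ
        rw [leftWord_tmul, prod_interleave _ σ hg, mul_smul]
        congr 1
        have h1 : ((interleave σ).map fun i => (LinearMap.mulLeft F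
            (toFree S r s (FreeNonUnitalNonAssocAlgebra.of F (j i))) : Module.End F B)) =
            ((interleave σ).map j).map op := by
          rw [List.map_map]; rfl
        rw [h1, map_interleave σ j]
        have h2 : ∀ (e : F) (u : Grassmann F), LinearMap.mulLeft F (e • u) =
            e • LinearMap.mulLeft F u := fun e u => by ext; simp
        rw [h2, TensorProduct.map_smul_left]
        rfl
      simp only [hval]
      rw [← Finset.sum_fiberwise Finset.univ
        (fun σ : Equiv.Perm (Fin m) => fun i => j (Sum.inl (σ i)))]
      refine Finset.sum_eq_zero fun k _ => ?_
      rw [← zero_smul F (val k), ← hc j k, Finset.sum_smul]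
      refine Finset.sum_congr rfl fun σ hσ => ?_
      rw [(Finset.mem_filter.1 hσ).2]

/-- For large `m` there are fewer conditions on the coefficients `c σ` than coefficients. -/
theorem exists_superSatisfies_interleavePoly {S : Set (NAPoly F)}
    (hS : (x F 0 * x F 1) * (x F 2 * x F 3) ∈ S) (r s : ℕ) :
    ∃ (m : ℕ) (c : Equiv.Perm (Fin m) → F), c ≠ 0 ∧
      SuperSatisfies (interleavePoly c) (freeSuperalgebra S r s) := by
  -- The exponent `3` counts one choice of generator for each `a`-letter, each `b`-letter and each
  -- entry of `k`.
  obtain ⟨m, hm⟩ := (Nat.eventually_pow_lt_factorial_sub ((r + s) ^ 3) 0).exists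
  let f : (Equiv.Perm (Fin m) → F) →ₗ[F]
      ((Fin m ⊕ Fin m → Fin r ⊕ Fin s) × (Fin m → Fin r ⊕ Fin s) → F) :=
    LinearMap.pi fun jk => ∑ σ : Equiv.Perm (Fin m) with (fun i => jk.1 (Sum.inl (σ i))) = jk.2,
      interleaveSign F (fun i => parity (FreeMagma.of (jk.1 i))) σ • LinearMap.proj σ
  have hf : f.ker ≠ ⊥ := by
    refine LinearMap.ker_ne_bot_of_finrank_lt ?_
    simp only [Module.finrank_fintype_fun_eq_card, Fintype.card_prod, Fintype.card_fun,
      Fintype.card_sum, Fintype.card_fin, Fintype.card_perm]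
    have h : (r + s) ^ (m + m) * (r + s) ^ m = ((r + s) ^ 3) ^ m := by
      rw [← pow_add, ← pow_mul]
      congr 1
      ring
    rwa [h]
  obtain ⟨c, hc, hc0⟩ := Submodule.exists_mem_ne_zero_of_ne_bot hf
  refine ⟨m, c, hc0, superSatisfies_interleavePoly hS c fun j k => ?_⟩
  have h := congrFun (LinearMap.mem_ker.1 hc) (j, k)
  simpa [f, mul_comm] using h

end FreeSuperalgebra

/-! ### An algebra of the variety `V^⟨ε⟩` -/

/-- The underlying space of the split null extension of `D ⊕ F` by `D ⊕ (D ⊕ D)`. -/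
@[ext] structure ModelAlgebra (F D : Type u) (ε : F) : Type u where
  p : D
  s : F
  e : D
  u : D
  v : D

namespace ModelAlgebra

variable {F D : Type u} [Field F] [Ring D] {ε : F}

instance : Zero (ModelAlgebra F D ε) := ⟨⟨0, 0, 0, 0, 0⟩⟩
instance : Add (ModelAlgebra F D ε) :=
  ⟨fun z w => ⟨z.p + w.p, z.s + w.s, z.e + w.e, z.u + w.u, z.v + w.v⟩⟩
instance : Neg (ModelAlgebra F D ε) := ⟨fun z => ⟨-z.p, -z.s, -z.e, -z.u, -z.v⟩⟩

@[simp] theorem zero_p : (0 : ModelAlgebra F D ε).p = 0 := rfl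
@[simp] theorem zero_s : (0 : ModelAlgebra F D ε).s = 0 := rfl
@[simp] theorem zero_e : (0 : ModelAlgebra F D ε).e = 0 := rfl
@[simp] theorem zero_u : (0 : ModelAlgebra F D ε).u = 0 := rfl
@[simp] theorem zero_v : (0 : ModelAlgebra F D ε).v = 0 := rfl
@[simp] theorem add_p (z w : ModelAlgebra F D ε) : (z + w).p = z.p + w.p := rfl
@[simp] theorem add_s (z w : ModelAlgebra F D ε) : (z + w).s = z.s + w.s := rfl
@[simp] theorem add_e (z w : ModelAlgebra F D ε) : (z + w).e = z.e + w.e := rfl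
@[simp] theorem add_u (z w : ModelAlgebra F D ε) : (z + w).u = z.u + w.u := rfl
@[simp] theorem add_v (z w : ModelAlgebra F D ε) : (z + w).v = z.v + w.v := rfl
@[simp] theorem neg_p (z : ModelAlgebra F D ε) : (-z).p = -z.p := rfl
@[simp] theorem neg_s (z : ModelAlgebra F D ε) : (-z).s = -z.s := rfl
@[simp] theorem neg_e (z : ModelAlgebra F D ε) : (-z).e = -z.e := rfl
@[simp] theorem neg_u (z : ModelAlgebra F D ε) : (-z).u = -z.u := rfl
@[simp] theorem neg_v (z : ModelAlgebra F D ε) : (-z).v = -z.v := rfl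

instance : AddCommGroup (ModelAlgebra F D ε) where
  add_assoc _ _ _ := by ext <;> simp [add_assoc]
  zero_add _ := by ext <;> simp
  add_zero _ := by ext <;> simp
  add_comm _ _ := by ext <;> simp [add_comm]
  neg_add_cancel _ := by ext <;> simp
  nsmul := nsmulRec
  zsmul := zsmulRec

@[simp] theorem sub_p (z w : ModelAlgebra F D ε) : (z - w).p = z.p - w.p := by
  rw [sub_eq_add_neg, add_p, neg_p, sub_eq_add_neg]
@[simp] theorem sub_s (z w : ModelAlgebra F D ε) : (z - w).s = z.s - w.s := by
  rw [sub_eq_add_neg, add_s, neg_s, sub_eq_add_neg]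
@[simp] theorem sub_e (z w : ModelAlgebra F D ε) : (z - w).e = z.e - w.e := by
  rw [sub_eq_add_neg, add_e, neg_e, sub_eq_add_neg]
@[simp] theorem sub_u (z w : ModelAlgebra F D ε) : (z - w).u = z.u - w.u := by
  rw [sub_eq_add_neg, add_u, neg_u, sub_eq_add_neg]
@[simp] theorem sub_v (z w : ModelAlgebra F D ε) : (z - w).v = z.v - w.v := by
  rw [sub_eq_add_neg, add_v, neg_v, sub_eq_add_neg]

variable [Algebra F D]

instance : SMul F (ModelAlgebra F D ε) :=
  ⟨fun c z => ⟨c • z.p, c • z.s, c • z.e, c • z.u, c • z.v⟩⟩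
-- The pair `(p, s)` acts on the module of triples `(e, u, v)`. Left multiplication sends `e` to
-- `(u, v) = (p e, s e)` and `(u, v)` back to `-ε (s u - p v)` in the slot `e`. Right multiplication
-- kills `e` and, when `ε² = 1`, is `ε` times left multiplication on `(u, v)`.
instance : Mul (ModelAlgebra F D ε) :=
  ⟨fun z w => ⟨0, 0, -(ε • (z.s • w.u - z.p * w.v)) - (w.s • z.u - w.p * z.v),
    z.p * w.e, z.s • w.e⟩⟩

@[simp] theorem smul_p (c : F) (z : ModelAlgebra F D ε) : (c • z).p = c • z.p := rfl
@[simp] theorem smul_s (c : F) (z : ModelAlgebra F D ε) : (c • z).s = c * z.s := rfl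
@[simp] theorem smul_e (c : F) (z : ModelAlgebra F D ε) : (c • z).e = c • z.e := rfl
@[simp] theorem smul_u (c : F) (z : ModelAlgebra F D ε) : (c • z).u = c • z.u := rfl
@[simp] theorem smul_v (c : F) (z : ModelAlgebra F D ε) : (c • z).v = c • z.v := rfl
@[simp] theorem mul_p (z w : ModelAlgebra F D ε) : (z * w).p = 0 := rfl
@[simp] theorem mul_s (z w : ModelAlgebra F D ε) : (z * w).s = 0 := rfl
@[simp] theorem mul_e (z w : ModelAlgebra F D ε) : (z * w).e =
    -(ε • (z.s • w.u - z.p * w.v)) - (w.s • z.u - w.p * z.v) := rfl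
@[simp] theorem mul_u (z w : ModelAlgebra F D ε) : (z * w).u = z.p * w.e := rfl
@[simp] theorem mul_v (z w : ModelAlgebra F D ε) : (z * w).v = z.s • w.e := rfl

instance : Module F (ModelAlgebra F D ε) where
  one_smul _ := by ext <;> simp
  mul_smul _ _ _ := by ext <;> simp [mul_smul, mul_assoc]
  smul_zero _ := by ext <;> simp
  smul_add _ _ _ := by ext <;> simp [mul_add]
  add_smul _ _ _ := by ext <;> simp [add_smul, add_mul]
  zero_smul _ := by ext <;> simp

instance : NonUnitalNonAssocRing (ModelAlgebra F D ε) where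
  left_distrib _ _ _ := by
    ext <;> simp only [mul_p, mul_s, mul_e, mul_u, mul_v, add_p, add_s, add_e, add_u, add_v,
      mul_add, add_mul, smul_add, add_smul, add_zero]
    simp only [smul_sub, smul_add]
    abel
  right_distrib _ _ _ := by
    ext <;> simp only [mul_p, mul_s, mul_e, mul_u, mul_v, add_p, add_s, add_e, add_u, add_v,
      mul_add, add_mul, smul_add, add_smul, add_zero]
    simp only [smul_sub, smul_add]
    abel
  zero_mul _ := by ext <;> simp
  mul_zero _ := by ext <;> simp

instance : IsScalarTower F (ModelAlgebra F D ε) (ModelAlgebra F D ε) where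
  smul_assoc c z w := by
    rw [smul_eq_mul, smul_eq_mul]
    ext
    · simp
    · simp
    · simp only [mul_e, smul_p, smul_s, smul_u, smul_v, smul_e, smul_mul_assoc, mul_smul_comm]
      module
    · simp
    · simp [mul_smul]

instance : SMulCommClass F (ModelAlgebra F D ε) (ModelAlgebra F D ε) where
  smul_comm c z w := by
    rw [smul_eq_mul, smul_eq_mul]
    ext
    · simp
    · simp
    · simp only [mul_e, smul_p, smul_s, smul_u, smul_v, smul_e, smul_mul_assoc, mul_smul_comm]
      module
    · simp
    · simp [smul_comm c]

theorem metabelian (a b c d : ModelAlgebra F D ε) : (a * b) * (c * d) = 0 := by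
  ext <;> simp

/-- On the slot `e` this amounts to the anticommutation of left multiplications, which holds because
`s` is a scalar; on `(u, v)` it reduces to right multiplication being `ε` times left multiplication.
Two successive right multiplications vanish on the module. -/
theorem associator_eq (hε : ε = 1 ∨ ε = -1) (a b c : ModelAlgebra F D ε) :
    associator a b c - ε • associator a c b = 0 := by
  rcases hε with rfl | rfl <;> ext <;>
    simp [associator, mul_sub] <;> module

/-- The inner bracket has zero `e` slot, and on the slots `u`, `v` right multiplication is `ε` times
left multiplication. -/
theorem epsBracket_eq (hε : ε = 1 ∨ ε = -1) (a b c : ModelAlgebra F D ε) :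
    (a * b - ε • (b * a)) * c - ε • (c * (a * b - ε • (b * a))) = 0 := by
  rcases hε with rfl | rfl <;> ext <;>
    simp [mul_add, mul_sub, smul_sub, smul_smul] <;> module

end ModelAlgebra

/-! ### Identities of the even part of `G ⊗ A` -/

section EvenTensors

variable {F : Type u} [Field F] {A : Type u} [NonUnitalNonAssocRing A] [Module F A]
  [IsScalarTower F A A] [SMulCommClass F A A] {ε : F}

/-- The tensors `g ⊗ a` with even `g`. -/
def evenTensors (F : Type u) [Field F] (A : Type u) [AddCommGroup A] [Module F A] :
    Set (Grassmann F ⊗[F] A) :=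
  {t | ∃ g ∈ grassmannPart F 0, ∃ a : A, t = g ⊗ₜ[F] a}

theorem even_mul_comm {g h : Grassmann F} (hg : g ∈ grassmannPart F 0)
    (hh : h ∈ grassmannPart F 0) : g * h = h * g := by
  simpa using grassmann_mul_comm hg hh

/-- An identity of the form `(a,b,c) = ε (a,c,b)` passes to the even part of `G ⊗ A`. -/
theorem associator_eq_of_mem_span_evenTensors
    (hA : ∀ a b c : A, associator a b c - ε • associator a c b = 0) (z : Fin 3 → Grassmann F ⊗[F] A)
    (hz : ∀ i, z i ∈ Submodule.span F (evenTensors F A)) :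
    associator (z 0) (z 1) (z 2) - ε • associator (z 0) (z 2) (z 1) = 0 := by
  let Φ : (Fin 3 → Grassmann F ⊗[F] A) → Grassmann F ⊗[F] A := fun z =>
    associator (z 0) (z 1) (z 2) - ε • associator (z 0) (z 2) (z 1)
  refine eq_zero_of_mem_span (R := F) Φ (fun z i =>
    ⟨IsLinearMap.mk' (fun b => Φ (Function.update z i b)) ⟨?_, ?_⟩, fun b => rfl⟩)
    (evenTensors F A) ?_ z hz
  · intro b c
    fin_cases i <;> simp [Φ, associator, add_mul, mul_add]
    all_goals module
  · intro b c
    fin_cases i <;> simp [Φ, associator, mul_smul_comm, smul_mul_assoc]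
    all_goals module
  · intro z hz
    choose g hg b hb using hz
    simp only [Φ, associator, hb, Algebra.TensorProduct.tmul_mul_tmul]
    -- Even coefficients commute, so both associators carry the same Grassmann factor.
    rw [mul_assoc, mul_assoc, even_mul_comm (hg 2) (hg 1),
      ← TensorProduct.tmul_sub, ← TensorProduct.tmul_sub, ← TensorProduct.tmul_smul,
      ← TensorProduct.tmul_sub]
    exact (congrArg _ (hA _ _ _)).trans (TensorProduct.tmul_zero _ _)

/-- An identity of the form `⟨⟨a,b⟩_ε,c⟩_ε = 0` passes to the even part of `G ⊗ A`. -/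
theorem bracket_eq_of_mem_span_evenTensors
    (hA : ∀ a b c : A, (a * b - ε • (b * a)) * c - ε • (c * (a * b - ε • (b * a))) = 0)
    (z : Fin 3 → Grassmann F ⊗[F] A) (hz : ∀ i, z i ∈ Submodule.span F (evenTensors F A)) :
    (z 0 * z 1 - ε • (z 1 * z 0)) * z 2 - ε • (z 2 * (z 0 * z 1 - ε • (z 1 * z 0))) = 0 := by
  let Φ : (Fin 3 → Grassmann F ⊗[F] A) → Grassmann F ⊗[F] A := fun z =>
    (z 0 * z 1 - ε • (z 1 * z 0)) * z 2 - ε • (z 2 * (z 0 * z 1 - ε • (z 1 * z 0)))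
  refine eq_zero_of_mem_span (R := F) Φ (fun z i =>
    ⟨IsLinearMap.mk' (fun b => Φ (Function.update z i b)) ⟨?_, ?_⟩, fun b => rfl⟩)
    (evenTensors F A) ?_ z hz
  · intro b c
    fin_cases i <;> simp [Φ, add_mul, mul_add, sub_mul, mul_sub, mul_smul_comm, smul_mul_assoc] <;>
      module
  · intro b c
    fin_cases i <;> simp [Φ, sub_mul, mul_sub, mul_smul_comm, smul_mul_assoc] <;> module
  · intro z hz
    choose g hg b hb using hz
    have h01 : g 0 * g 1 ∈ grassmannPart F 0 := by
      simpa using SetLike.mul_mem_graded (A := grassmannPart F) (hg 0) (hg 1)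
    simp only [Φ, hb, Algebra.TensorProduct.tmul_mul_tmul]
    rw [even_mul_comm (hg 1) (hg 0), ← TensorProduct.tmul_smul, ← TensorProduct.tmul_sub,
      Algebra.TensorProduct.tmul_mul_tmul, Algebra.TensorProduct.tmul_mul_tmul,
      even_mul_comm (hg 2) h01, ← TensorProduct.tmul_smul, ← TensorProduct.tmul_sub]
    exact (congrArg _ (hA _ _ _)).trans (TensorProduct.tmul_zero _ _)

end EvenTensors

/-! ### The model algebra as a superalgebra with zero odd part -/

section Model

variable {F : Type u} [Field F]

/-- The model algebra, all of whose elements are taken to be even. -/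
noncomputable def modelSuperalgebra (D : Type u) [Ring D] [Algebra F D] (ε : F) :
    Superalgebra.{u} F where
  carrier := ModelAlgebra F D ε
  part i := if i = 0 then ⊤ else ⊥
  isCompl := by simpa using isCompl_top_bot
  mul_mem i j a b ha hb := by
    have h2 : ∀ i : ZMod 2, i = 0 ∨ i = 1 := by decide
    rcases h2 i with rfl | rfl
    · rcases h2 j with rfl | rfl
      · simp
      · obtain rfl : b = 0 := by simpa using hb
        rw [mul_zero]
        exact zero_mem _
    · obtain rfl : a = 0 := by simpa using ha
      rw [zero_mul]
      exact zero_mem _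

variable {D : Type u} [Ring D] [Algebra F D] {ε : F}

theorem mem_span_evenTensors {t : Grassmann F ⊗[F] ModelAlgebra F D ε}
    (ht : t ∈ envelope (modelSuperalgebra D ε)) :
    t ∈ Submodule.span F (evenTensors F (ModelAlgebra F D ε)) := by
  refine Submodule.span_le.2 ?_ ht
  rintro _ ⟨i, g, hg, a, ha, rfl⟩
  have h2 : i = 0 ∨ i = 1 := by
    clear hg ha
    revert i
    decide
  rcases h2 with rfl | rfl
  · exact Submodule.subset_span ⟨g, hg, a, rfl⟩
  · obtain rfl : a = 0 := (Submodule.mem_bot F).1 ha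
    rw [TensorProduct.tmul_zero]
    exact zero_mem _

theorem mem_part_zero (a : ModelAlgebra F D ε) : a ∈ (modelSuperalgebra D ε).part 0 :=
  Submodule.mem_top (R := F)

/-- The embedding `a ↦ 1 ⊗ a` of the model algebra into the Grassmann envelope. -/
noncomputable def toEnvelope (a : ModelAlgebra F D ε) : envelope (modelSuperalgebra D ε) :=
  ⟨(1 : Grassmann F) ⊗ₜ[F] a, tmul_mem_envelope SetLike.GradedOne.one_mem (mem_part_zero a)⟩

theorem toEnvelope_mul (a b : ModelAlgebra F D ε) :
    toEnvelope (a * b) = toEnvelope a * toEnvelope b := by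
  refine Subtype.ext ?_
  refine Eq.trans ?_ (Algebra.TensorProduct.tmul_mul_tmul (R := F) (1 : Grassmann F) 1 a b).symm
  rw [mul_one]
  rfl

theorem modelSuperalgebra_mem_superVariety (hε : ε = 1 ∨ ε = -1) :
    modelSuperalgebra D ε ∈ superVariety (epsIdentities ε) := by
  rintro f (rfl | rfl | rfl) a <;>
    refine Subtype.ext ?_ <;>
    simp only [epsBracket, associator, map_mul, map_sub, map_smul, x,
      FreeNonUnitalNonAssocAlgebra.lift_of_apply]
  · exact tensor_mul_mul_mul_eq_zero (B := (modelSuperalgebra D ε).carrier)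
      ModelAlgebra.metabelian _ _ _ _
  · exact associator_eq_of_mem_span_evenTensors (A := (modelSuperalgebra D ε).carrier)
      (ModelAlgebra.associator_eq hε) (fun i => (a i).1) fun i => mem_span_evenTensors (a i).2
  · exact bracket_eq_of_mem_span_evenTensors (A := (modelSuperalgebra D ε).carrier)
      (ModelAlgebra.epsBracket_eq hε) (fun i => (a i).1) fun i => mem_span_evenTensors (a i).2

/-- The interleaved words act on the model algebra as the words of the free monoid. -/
theorem leftWord_model {m : ℕ} (hε : ε * ε = 1) (t : Fin m → D) (σ : Equiv.Perm (Fin m))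
    (l : List (Fin m)) :
    leftWord (Sum.elim (fun i => ⟨t i, 0, 0, 0, 0⟩) (fun _ => ⟨0, -ε, 0, 0, 0⟩) :
      Fin m ⊕ Fin m → ModelAlgebra F D ε) ⟨0, 0, 1, 0, 0⟩
      (l.flatMap fun i => [Sum.inr i, Sum.inl (σ i)]) =
    ⟨0, 0, (l.map fun i => t (σ i)).prod, 0, 0⟩ := by
  induction l with
  | nil => rfl
  | cons i l ih =>
    rw [List.flatMap_cons, leftWord_append, ih]
    -- The `a`-letter moves `e` to `u` with the factor `t (σ i)`; the `b`-letter returns `u` to `e`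
    -- with the factor `-ε * (-ε) = 1`, whence the choice `s = -ε`.
    ext <;> simp [smul_smul, hε]

theorem model_mul (hε : ε * ε = 1) : (⟨0, 1, 0, 0, 0⟩ * ⟨0, 0, 0, -ε • 1, 0⟩ :
    ModelAlgebra F D ε) = ⟨0, 0, 1, 0, 0⟩ := by
  ext <;> simp [smul_smul, hε]

theorem not_superSatisfies_interleavePoly {m : ℕ} {c : Equiv.Perm (Fin m) → F} (hc : c ≠ 0)
    (hε : ε * ε = 1) : ¬ SuperSatisfies (interleavePoly c)
      (modelSuperalgebra (MonoidAlgebra F (FreeMonoid (Fin m))) ε) := by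
  intro h
  let D := MonoidAlgebra F (FreeMonoid (Fin m))
  let t : Fin m → D := fun i => MonoidAlgebra.of F _ (FreeMonoid.of i)
  let β : Fin m ⊕ Fin m → ModelAlgebra F D ε :=
    Sum.elim (fun i => ⟨t i, 0, 0, 0, 0⟩) (fun _ => ⟨0, -ε, 0, 0, 0⟩)
  -- The first two values are chosen so that `x₀x₁` becomes the unit in the slot `e`.
  let α : ℕ → ModelAlgebra F D ε := fun n =>
    if n = 0 then ⟨0, 1, 0, 0, 0⟩ else if n = 1 then ⟨0, 0, 0, -ε • 1, 0⟩
    else Function.extend varIndex β 0 n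
  have hα : ∀ i, α (varIndex i) = β i := fun i => by
    have := two_le_varIndex i
    simp only [α]
    rw [if_neg (by omega), if_neg (by omega), varIndex_injective.extend_apply]
  have hα01 : α 0 * α 1 = ⟨0, 0, 1, 0, 0⟩ := model_mul hε
  let φ : ModelAlgebra F D ε →ₙ* envelope (modelSuperalgebra D ε) :=
    ⟨toEnvelope, toEnvelope_mul⟩
  have h1 := (lift_interleavePoly c (fun n => φ (α n))).symm.trans (h fun n => φ (α n))
  simp only [← map_mul, ← map_leftWord, hα, hα01] at h1
  have h2 : (1 : Grassmann F) ⊗ₜ[F]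
      (∑ σ, c σ • leftWord β ⟨0, 0, 1, 0, 0⟩ (interleave σ)) = 0 := by
    have h3 := congrArg (NonUnitalSubalgebraClass.subtype (envelope (modelSuperalgebra D ε))) h1
    rw [map_sum, map_zero] at h3
    rw [TensorProduct.tmul_sum]
    simp only [TensorProduct.tmul_smul]
    exact h3
  have h4 := eq_zero_of_tmul_eq_zero one_ne_zero h2
  simp only [interleave, β, leftWord_model hε] at h4
  let e : ModelAlgebra F D ε →ₗ[F] D :=
    { toFun := ModelAlgebra.e, map_add' := fun _ _ => rfl, map_smul' := fun _ _ => rfl }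
  have h5 := congrArg e h4
  rw [map_sum, map_zero] at h5
  refine hc (funext fun τ => ?_)
  -- Since `w` is injective, the coefficient at `w τ` of the slot `e` is exactly `c τ`.
  let w : Equiv.Perm (Fin m) → FreeMonoid (Fin m) := fun σ =>
    FreeMonoid.ofList ((List.finRange m).map σ)
  have hw : Function.Injective w := fun σ σ' hσ => by
    refine Equiv.ext fun i => ?_
    exact List.map_inj_left.1 (FreeMonoid.ofList.injective hσ) i (List.mem_finRange i)
  have ht : ∀ σ : Equiv.Perm (Fin m), ((List.finRange m).map fun i => t (σ i)).prod =
      MonoidAlgebra.single (w σ) 1 := fun σ => by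
    change _ = MonoidAlgebra.of F _ (w σ)
    have : w σ = ((List.finRange m).map fun i => FreeMonoid.of (σ i)).prod := by
      simp only [w]
      induction List.finRange m with
      | nil => rfl
      | cons i l ih => rw [List.map_cons, List.map_cons, List.prod_cons, ← ih]; rfl
    rw [this, map_list_prod, List.map_map]
    rfl
  have h6 := congrArg (fun d : D => d.coeff (w τ)) h5
  simp only [map_smul] at h6
  change (∑ σ, c σ • ((List.finRange m).map fun i => t (σ i)).prod : D).coeff (w τ) = 0 at h6
  simp only [ht] at h6
  rw [MonoidAlgebra.coeff_sum, Finsupp.finsetSum_apply, Finset.sum_eq_single τ] at h6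
  · rw [MonoidAlgebra.coeff_smul_apply, MonoidAlgebra.coeff_single, Finsupp.single_eq_same,
      smul_eq_mul, mul_one] at h6
    exact h6
  · intro σ _ hσ
    rw [MonoidAlgebra.coeff_smul_apply, MonoidAlgebra.coeff_single,
      Finsupp.single_eq_of_ne fun h => hσ (hw h.symm), smul_zero]
  · exact fun h => absurd (Finset.mem_univ τ) h

end Model

end Superrank

theorem mainTheorem9 {F : Type u} [Field F] [CharZero F] (ε : F) (hε : ε = 1 ∨ ε = -1) :
    Superrank.HasInfiniteBasicSuperrank (Superrank.epsIdentities ε) := by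
  intro r s h
  obtain ⟨m, c, hc, hsat⟩ :=
    Superrank.exists_superSatisfies_interleavePoly (S := Superrank.epsIdentities ε)
      (Set.mem_insert _ _) r s
  have hε2 : ε * ε = 1 := by rcases hε with rfl | rfl <;> simp
  have hmem : Superrank.modelSuperalgebra (MonoidAlgebra F (FreeMonoid (Fin m))) ε ∈
      Superrank.generatedByFree (Superrank.epsIdentities ε) r s :=
    h ▸ Superrank.modelSuperalgebra_mem_superVariety hε
  exact Superrank.not_superSatisfies_interleavePoly hc hε2
    (hmem _ (Superrank.isMultilinear_interleavePoly c) hsat)
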